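/- Let $j$ and $k$ be positive integers, let $f(x)$ be one of the functions $e^{x^j}$, $\sin x$, $\cos x$, $\tan x$, $\csc x$, $\sec x$, $\cot x$, $\sinh x$, $\cosh x$, $\tanh x$, $\coth x$ of a complex variable, let $g(x)\in\mathbb{Q}[x]$, and let $a_1\in\mathbb{C}$ be an algebraic number. If $\alpha\in\mathbb{C}$, $\alpha\neq 0$, is a solution of the equation $$(f(x)+a_1)^k=g(x)$$ (in particular, $f$ is defined at $\alpha$) such that $f(\alpha)\neq 0$ and $g(\alpha)\neq 0$, then $\alpha$ is transcendental over $\mathbb{Q}$. -/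

import Mathlib

namespace ExpTrig

/-- The complex cosecant; at the poles (where `Complex.sin x = 0`) the value is `0`. -/
noncomputable def csc (x : ℂ) : ℂ := 1 / Complex.sin x

/-- The complex secant; at the poles (where `Complex.cos x = 0`) the value is `0`. -/
noncomputable def sec (x : ℂ) : ℂ := 1 / Complex.cos x

/-- The complex hyperbolic cotangent; at the poles (where `Complex.sinh x = 0`) the value is `0`. -/
noncomputable def coth (x : ℂ) : ℂ := Complex.cosh x / Complex.sinh x

/-- The functions `e^(x^j)`, sin, cos, tan, csc, sec, cot, sinh, cosh, tanh, coth of a complex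
variable. Those with poles take the value `0` at each pole, so the condition `f α ≠ 0` implies
that `f` is defined at `α`. -/
def functions (j : ℕ) : Set (ℂ → ℂ) :=
  {fun x => Complex.exp (x ^ j),
    Complex.sin, Complex.cos, Complex.tan, csc, sec, Complex.cot,
    Complex.sinh, Complex.cosh, Complex.tanh, coth}

end ExpTrig

open Polynomial

/-! If `α` were algebraic, so would be `g(α)`, its `k`-th root `f(α) + a₁`, and `f(α)`. But `f` is
transcendental at nonzero algebraic points where it does not vanish
(`ExpTrig.transcendental_apply`), because algebraicity of `f(α)` would make an exponential of a
nonzero algebraic number algebraic, against Hermite–Lindemann (`transcendental_exp`).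

The analytic core is `sum_mul_exp_ne_zero`. Hermite's approximations `n * e^x ≈ p * g(x)`, with `p ∤
n` and error `c^p / (p-1)!`, would turn a vanishing Galois-stable sum into a nonzero integer of
absolute value below 1. -/

theorem exists_int_polynomial_aeval_eq_zero {K : Type*} [Field K] [Algebra.IsAlgebraic ℤ K]
    (s : Finset K) (hs : 0 ∉ s) :
    ∃ f : ℤ[X], f.eval 0 ≠ 0 ∧ ∀ x ∈ s, aeval x f = 0 := by
  have h (x : K) (hx : x ≠ 0) : ∃ q : ℤ[X], q.coeff 0 ≠ 0 ∧ aeval x q = 0 :=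
    (Algebra.IsAlgebraic.isAlgebraic x).exists_nonzero_coeff_and_aeval_eq_zero
      (mem_nonZeroDivisors_of_ne_zero hx)
  choose! q hq using h
  have hne (x : K) (hx : x ∈ s) : x ≠ 0 := fun h ↦ hs (h ▸ hx)
  refine ⟨∏ x ∈ s, q x, ?_, fun x hx ↦ ?_⟩
  · rw [eval_prod, Finset.prod_ne_zero_iff]
    intro x hx
    rw [← coeff_zero_eq_eval_zero]
    exact (hq x (hne x hx)).1
  · rw [map_prod]
    exact Finset.prod_eq_zero hx (hq x (hne x hx)).2

theorem isIntegral_pow_mul_aeval {R : Type*} [CommRing R] {a : ℤ} {x : R}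
    (h : IsIntegral ℤ (a * x)) {g : ℤ[X]} {m : ℕ} (hg : g.natDegree ≤ m) :
    IsIntegral ℤ (a ^ m * aeval x g) := by
  rw [aeval_eq_sum_range' (Nat.lt_succ_of_le hg), Finset.mul_sum]
  refine IsIntegral.sum _ fun i hi ↦ ?_
  have hi : i ≤ m := Nat.lt_succ_iff.mp (Finset.mem_range.mp hi)
  have : (a : R) ^ m * g.coeff i • x ^ i =
      ((g.coeff i * a ^ (m - i) : ℤ) : R) * (a * x) ^ i := by
    rw [mul_pow, zsmul_eq_mul, ← Nat.sub_add_cancel hi, pow_add, Nat.add_sub_cancel]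
    push_cast
    ring
  rw [this]
  exact IsIntegral.mul (isIntegral_algebraMap (R := ℤ)) (h.pow i)

theorem exists_int_eq_of_isIntegral_of_fixed {K : Type*} [Field K] [NumberField K] [IsGalois ℚ K]
    {x : K} (hx : IsIntegral ℤ x) (hfix : ∀ σ : K ≃ₐ[ℚ] K, σ x = x) : ∃ m : ℤ, (m : K) = x := by
  obtain ⟨q, rfl⟩ := IntermediateField.mem_bot.mp ((IsGalois.mem_bot_iff_fixed x).mpr hfix)
  rw [isIntegral_algebraMap_iff (algebraMap ℚ K).injective] at hx
  obtain ⟨m, rfl⟩ := IsIntegrallyClosed.isIntegral_iff.mp hx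
  exact ⟨m, by simp⟩

/-- A linear combination of exponentials of algebraic numbers, with integer coefficients that are
constant on Galois orbits and with a nonzero constant term, does not vanish. -/
theorem sum_mul_exp_ne_zero {K : Type*} [Field K] [NumberField K] [IsGalois ℚ K] (φ : K →+* ℂ)
    (F : K →₀ ℤ) (hF : ∀ (σ : K ≃ₐ[ℚ] K) (x : K), F (σ x) = F x) (h0 : F 0 ≠ 0) :
    F.sum (fun x c ↦ (c : ℂ) * Complex.exp (φ x)) ≠ 0 := by
  classical
  intro hsum
  have : Algebra.IsAlgebraic ℤ K :=
    (IsFractionRing.comap_isAlgebraic_iff (K := ℚ)).mpr inferInstance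
  set s := F.support.erase 0 with hs
  have hsum' : (F 0 : ℂ) + ∑ x ∈ s, (F x : ℂ) * Complex.exp (φ x) = 0 := by
    rw [← hsum, Finsupp.sum, ← Finset.add_sum_erase _ _ (Finsupp.mem_support_iff.mpr h0)]
    simp [hs]
  obtain ⟨f, hf0, hf⟩ := exists_int_polynomial_aeval_eq_zero s (by simp [hs])
  obtain ⟨a, ha0, ha⟩ := exists_integral_multiples ℤ ℚ (L := K) s
  obtain ⟨c, hc⟩ := LindemannWeierstrass.exp_polynomial_approx f hf0
  set B : ℝ := ∑ x ∈ s, |(F x : ℝ)| with hB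
  have key (p : ℕ) (hp : p.Prime) (hpf : (f.eval 0).natAbs < p) (hpa : a.natAbs < p)
      (hpF : (F 0).natAbs < p) :
      1 ≤ |(a : ℝ)| ^ (p * f.natDegree) * (B * (c ^ p / (p - 1).factorial)) := by
    obtain ⟨n, hn, g, hg, happ⟩ := hc p hpf hp
    set d := p * f.natDegree
    -- `a ^ d` clears denominators, and Galois permutes the terms: the sum is a rational algebraic
    -- integer.
    obtain ⟨M, hM⟩ : ∃ M : ℤ, (M : K) = ∑ x ∈ s, F x • (a ^ d * aeval x g) := by
      refine exists_int_eq_of_isIntegral_of_fixed (IsIntegral.sum _ fun x hx ↦ ?_) fun σ ↦ ?_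
      · refine IsIntegral.smul _ (isIntegral_pow_mul_aeval ?_ (hg.trans (Nat.sub_le _ _)))
        simpa using ha x hx
      · rw [map_sum]
        refine Finset.sum_equiv σ.toEquiv (fun x ↦ by simp [hs, hF]) fun x _ ↦ ?_
        have : σ (aeval x g) = aeval (σ x) g :=
          (aeval_algHom_apply (σ.toAlgHom.restrictScalars ℤ) x g).symm
        simp [hF, this]
    have hMφ : (M : ℂ) = a ^ d * ∑ x ∈ s, (F x : ℂ) * aeval (φ x) g := by
      rw [← map_intCast φ, hM, map_sum, Finset.mul_sum]
      refine Finset.sum_congr rfl fun x _ ↦ ?_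
      have : φ (aeval x g) = aeval (φ x) g := (aeval_algHom_apply φ.toIntAlgHom x g).symm
      simp [this]
      ring
    -- Nonzero modulo `p`, since `p` exceeds `|a|` and `|F 0|` and does not divide `n`.
    have hZ : a ^ d * n * F 0 + p * M ≠ 0 := by
      intro h
      have hpZ : Prime (p : ℤ) := Nat.prime_iff_prime_int.mp hp
      have hlt {b : ℤ} (hb : b ≠ 0) (hbp : b.natAbs < p) : ¬ (p : ℤ) ∣ b := fun hd ↦
        absurd (Nat.le_of_dvd (Int.natAbs_pos.mpr hb) (Int.natCast_dvd.mp hd)) (not_le.mpr hbp)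
      have hd : (p : ℤ) ∣ a ^ d * n * F 0 := ⟨-M, by linear_combination h⟩
      rcases hpZ.dvd_or_dvd hd with hd | hd
      · rcases hpZ.dvd_or_dvd hd with hd | hd
        · exact hlt ha0 hpa (hpZ.dvd_of_dvd_pow hd)
        · exact hn hd
      · exact hlt h0 hpF hd
    have hZeq : ((a ^ d * n * F 0 + p * M : ℤ) : ℂ) =
        -(a ^ d * ∑ x ∈ s, (F x : ℂ) * (n • Complex.exp (φ x) - p • aeval (φ x) g)) := by
      have : ∑ x ∈ s, (F x : ℂ) * (n • Complex.exp (φ x) - p • aeval (φ x) g) =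
          n * ∑ x ∈ s, (F x : ℂ) * Complex.exp (φ x) - p * ∑ x ∈ s, (F x : ℂ) * aeval (φ x) g := by
        rw [Finset.mul_sum, Finset.mul_sum, ← Finset.sum_sub_distrib]
        refine Finset.sum_congr rfl fun x _ ↦ ?_
        rw [zsmul_eq_mul, nsmul_eq_mul]
        ring
      rw [this]
      push_cast
      rw [hMφ]
      linear_combination (a : ℂ) ^ d * n * hsum'
    calc (1 : ℝ) ≤ ‖((a ^ d * n * F 0 + p * M : ℤ) : ℂ)‖ := by
          rw [Complex.norm_intCast]
          exact_mod_cast Int.one_le_abs hZ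
      _ = |(a : ℝ)| ^ d * ‖∑ x ∈ s, (F x : ℂ) * (n • Complex.exp (φ x) - p • aeval (φ x) g)‖ := by
          rw [hZeq, norm_neg, norm_mul, norm_pow, Complex.norm_intCast]
      _ ≤ _ := by
          refine mul_le_mul_of_nonneg_left ?_ (by positivity)
          rw [hB, Finset.sum_mul]
          refine norm_sum_le_of_le _ fun x hx ↦ ?_
          rw [norm_mul, Complex.norm_intCast]
          refine mul_le_mul_of_nonneg_left (happ ?_) (abs_nonneg _)
          rw [mem_aroots]
          refine ⟨fun h ↦ hf0 (by simp [h]), ?_⟩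
          have := aeval_algHom_apply φ.toIntAlgHom x f
          simpa [hf x hx] using this
  have hlim : Filter.Tendsto (fun p : ℕ ↦ |(a : ℝ)| ^ ((p + 1) * f.natDegree) *
      (B * (c ^ (p + 1) / p.factorial))) Filter.atTop (nhds 0) := by
    have := (FloorSemiring.tendsto_pow_div_factorial_atTop (|(a : ℝ)| ^ f.natDegree * c)).const_mul
      (|(a : ℝ)| ^ f.natDegree * B * c)
    rw [mul_zero] at this
    refine this.congr fun p ↦ ?_
    rw [mul_comm (p + 1), pow_mul]
    ring
  obtain ⟨N, hN⟩ := Filter.eventually_atTop.mp (hlim.eventually_lt_const zero_lt_one)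
  obtain ⟨p, hpN, hp⟩ := Nat.exists_infinite_primes
    (N + (f.eval 0).natAbs + a.natAbs + (F 0).natAbs + 1)
  have h₁ := key p hp (by omega) (by omega) (by omega)
  have h₂ := hN (p - 1) (by omega)
  rw [Nat.sub_add_cancel hp.one_le] at h₂
  exact absurd h₁ (not_le.mpr h₂)

/-- The algebra homomorphism `ℤ[K] → ℂ` with `single x n ↦ n * exp (φ x)`. -/
noncomputable def evalExp {K : Type*} [Field K] (φ : K →+* ℂ) : AddMonoidAlgebra ℤ K →ₐ[ℤ] ℂ :=
  AddMonoidAlgebra.lift ℤ ℂ K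
    { toFun := fun x ↦ Complex.exp (φ x.toAdd)
      map_one' := by simp
      map_mul' := fun x y ↦ by simp [Complex.exp_add] }

theorem evalExp_eq_sum {K : Type*} [Field K] (φ : K →+* ℂ) (x : AddMonoidAlgebra ℤ K) :
    evalExp φ x = x.coeff.sum fun y c ↦ (c : ℂ) * Complex.exp (φ y) := by
  simp [evalExp, AddMonoidAlgebra.lift_apply]

theorem evalExp_single {K : Type*} [Field K] (φ : K →+* ℂ) (x : K) (n : ℤ) :
    evalExp φ (.single x n) = n * Complex.exp (φ x) := by
  simp [evalExp_eq_sum]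

theorem aeval_single_one_ne_zero {M : Type*} [AddCommMonoid M] {a : M}
    (ha : Function.Injective fun n : ℕ ↦ n • a) {q : ℤ[X]} (hq : q ≠ 0) :
    aeval (AddMonoidAlgebra.single a (1 : ℤ)) q ≠ 0 := by
  classical
  intro h
  refine leadingCoeff_ne_zero.mpr hq ?_
  have := congrArg (fun x ↦ x.coeff (q.natDegree • a)) h
  simp only [aeval_eq_sum_range, AddMonoidAlgebra.single_pow, one_pow,
    AddMonoidAlgebra.coeff_sum, Finsupp.finsetSum_apply, AddMonoidAlgebra.coeff_smul_apply,
    AddMonoidAlgebra.coeff_single, AddMonoidAlgebra.coeff_zero, Finsupp.single_apply] at this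
  rw [Finset.sum_eq_single q.natDegree] at this
  · simpa using this
  · intro i _ hi
    rw [if_neg fun h ↦ hi (ha h), smul_zero]
  · simp

/-- Multiplying `x` by the sum of the `single (-σ z) 1` keeps it Galois-stable and makes its
constant term `|Gal| * x.coeff z`, so `sum_mul_exp_ne_zero` applies. -/
theorem evalExp_ne_zero_of_fixed {K : Type*} [Field K] [NumberField K] [IsGalois ℚ K]
    (φ : K →+* ℂ) {x : AddMonoidAlgebra ℤ K} (hx : x ≠ 0)
    (hfix : ∀ (σ : K ≃ₐ[ℚ] K) (y : K), x.coeff (σ y) = x.coeff y) : evalExp φ x ≠ 0 := by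
  classical
  intro h
  obtain ⟨z, hz⟩ : ∃ z, x.coeff z ≠ 0 := by
    by_contra! hz
    exact hx (AddMonoidAlgebra.ext (Finsupp.ext hz))
  set w : AddMonoidAlgebra ℤ K := ∑ σ : K ≃ₐ[ℚ] K, x * .single (-σ z) 1
  have hw (y : K) : w.coeff y = ∑ σ : K ≃ₐ[ℚ] K, x.coeff (y + σ z) := by
    simp only [w, AddMonoidAlgebra.coeff_sum, Finsupp.finsetSum_apply]
    refine Finset.sum_congr rfl fun σ _ ↦ ?_
    rw [AddMonoidAlgebra.coeff_mul_single_eq_coeff_mul (m₂ := y + σ z), mul_one]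
    intro m _
    rw [← sub_eq_add_neg, sub_eq_iff_eq_add]
  refine sum_mul_exp_ne_zero φ w.coeff (fun τ y ↦ ?_) ?_ ?_
  · rw [hw, hw]
    refine Fintype.sum_equiv (Equiv.mulLeft τ⁻¹) _ _ fun σ ↦ ?_
    rw [← hfix τ (y + _)]
    simp [AlgEquiv.mul_apply, AlgEquiv.aut_inv]
  · simp [hw, hfix, hz]
  · rw [← evalExp_eq_sum]
    simp [w, h]

theorem transcendental_exp_of_isGalois {K : Type*} [Field K] [NumberField K] [IsGalois ℚ K]
    (φ : K →+* ℂ) {a : K} (ha : a ≠ 0) : Transcendental ℤ (Complex.exp (φ a)) := by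
  classical
  rintro ⟨q, hq, hqa⟩
  let T (σ : K ≃ₐ[ℚ] K) : AddMonoidAlgebra ℤ K →ₐ[ℤ] AddMonoidAlgebra ℤ K :=
    AddMonoidAlgebra.mapDomainAlgHom ℤ ℤ (σ : K →+ K)
  have hT (σ : K ≃ₐ[ℚ] K) (y : K) : T σ (.single y 1) = .single (σ y) 1 := by simp [T]
  -- A formal norm: Galois permutes the factors, and the factor at `σ = 1` evaluates to `q (exp (φ
  -- a)) = 0`.
  let x : AddMonoidAlgebra ℤ K := ∏ σ : K ≃ₐ[ℚ] K, aeval (.single (σ a) 1) q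
  have hx : x ≠ 0 := by
    refine Finset.prod_ne_zero_iff.mpr fun σ _ ↦ aeval_single_one_ne_zero (fun m n h ↦ ?_) hq
    simpa [ha] using h
  have hTx (τ : K ≃ₐ[ℚ] K) : T τ x = x := by
    rw [map_prod]
    refine Fintype.prod_equiv (Equiv.mulLeft τ) _ _ fun σ ↦ ?_
    rw [← aeval_algHom_apply, hT]
    rfl
  refine evalExp_ne_zero_of_fixed φ hx (fun σ y ↦ ?_) ?_
  · conv_lhs => rw [← hTx σ]
    exact Finsupp.mapDomain_apply σ.injective _ _
  · rw [map_prod]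
    refine Finset.prod_eq_zero (Finset.mem_univ 1) ?_
    rw [← aeval_algHom_apply, evalExp_single]
    simpa using hqa

/-- The **Hermite–Lindemann theorem**. -/
theorem transcendental_exp {α : ℂ} (h : IsAlgebraic ℚ α) (hα : α ≠ 0) :
    Transcendental ℚ (Complex.exp α) := by
  let K := IntermediateField.adjoin ℚ ((minpoly ℚ α).rootSet ℂ)
  have : (minpoly ℚ α).IsSplittingField ℚ K :=
    IntermediateField.adjoin_rootSet_isSplittingField (IsAlgClosed.splits _)
  have : FiniteDimensional ℚ K := IsSplittingField.finiteDimensional K (minpoly ℚ α)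
  have : Normal ℚ K := .of_isSplittingField (minpoly ℚ α)
  have : NumberField K := ⟨⟩
  have : IsGalois ℚ K := ⟨⟩
  have hmem : α ∈ K := IntermediateField.subset_adjoin ℚ _
    ((mem_rootSet_of_ne (minpoly.ne_zero h.isIntegral)).mpr (minpoly.aeval ℚ α))
  have := transcendental_exp_of_isGalois K.val.toRingHom (a := ⟨α, hmem⟩)
    (fun h ↦ hα (congrArg Subtype.val h))
  intro h
  exact this ((IsFractionRing.isAlgebraic_iff ℤ ℚ ℂ).mpr h)
-- Hyperbolic and trigonometric functions
theorem isAlgebraic_I : IsAlgebraic ℚ Complex.I :=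
  .of_pow two_pos (by simpa using isAlgebraic_one.neg)

theorem transcendental_cosh {z : ℂ} (hz : IsAlgebraic ℚ z) (hz0 : z ≠ 0) :
    Transcendental ℚ (Complex.cosh z) := by
  intro h
  refine transcendental_exp hz hz0 ?_
  have : IsAlgebraic ℚ (Complex.sinh z) := by
    refine .of_pow two_pos ?_
    rw [Complex.sinh_sq]
    exact (h.pow 2).sub isAlgebraic_one
  rw [← Complex.cosh_add_sinh]
  exact h.add this

theorem transcendental_sinh {z : ℂ} (hz : IsAlgebraic ℚ z) (hz0 : z ≠ 0) :
    Transcendental ℚ (Complex.sinh z) := by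
  intro h
  refine transcendental_cosh hz hz0 (.of_pow two_pos ?_)
  rw [Complex.cosh_sq]
  exact (h.pow 2).add isAlgebraic_one

theorem transcendental_tanh {z : ℂ} (hz : IsAlgebraic ℚ z) (hz0 : z ≠ 0)
    (hc : Complex.cosh z ≠ 0) : Transcendental ℚ (Complex.tanh z) := by
  intro h
  refine transcendental_cosh hz hz0 (.of_pow two_pos ?_)
  have : Complex.cosh z ^ 2 = (1 - Complex.tanh z ^ 2)⁻¹ := by
    rw [Complex.tanh_eq_sinh_div_cosh]
    refine eq_inv_of_mul_eq_one_left ?_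
    field_simp
    exact Complex.cosh_sq_sub_sinh_sq z
  rw [this]
  exact (isAlgebraic_one.sub (h.pow 2)).inv

theorem transcendental_cos {z : ℂ} (hz : IsAlgebraic ℚ z) (hz0 : z ≠ 0) :
    Transcendental ℚ (Complex.cos z) := by
  rw [← Complex.cosh_mul_I]
  exact transcendental_cosh (hz.mul isAlgebraic_I) (mul_ne_zero hz0 Complex.I_ne_zero)

theorem transcendental_sin {z : ℂ} (hz : IsAlgebraic ℚ z) (hz0 : z ≠ 0) :
    Transcendental ℚ (Complex.sin z) := by
  intro h
  refine transcendental_sinh (hz.mul isAlgebraic_I) (mul_ne_zero hz0 Complex.I_ne_zero) ?_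
  rw [Complex.sinh_mul_I]
  exact h.mul isAlgebraic_I

theorem transcendental_tan {z : ℂ} (hz : IsAlgebraic ℚ z) (hz0 : z ≠ 0)
    (hc : Complex.cos z ≠ 0) : Transcendental ℚ (Complex.tan z) := by
  intro h
  refine transcendental_tanh (hz.mul isAlgebraic_I) (mul_ne_zero hz0 Complex.I_ne_zero)
    (by rwa [Complex.cosh_mul_I]) ?_
  rw [Complex.tanh_mul_I]
  exact h.mul isAlgebraic_I

theorem ExpTrig.transcendental_apply {j : ℕ} {f : ℂ → ℂ}
    (hf : f ∈ ExpTrig.functions j) {z : ℂ} (hz : IsAlgebraic ℚ z) (hz0 : z ≠ 0) (hfz : f z ≠ 0) :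
    Transcendental ℚ (f z) := by
  rcases hf with rfl | rfl | rfl | rfl | rfl | rfl | rfl | rfl | rfl | rfl | rfl
  · exact transcendental_exp (hz.pow j) (pow_ne_zero j hz0)
  · exact transcendental_sin hz hz0
  · exact transcendental_cos hz hz0
  -- At a pole the quotient takes the value `0`, which `hfz` excludes.
  · refine transcendental_tan hz hz0 fun h ↦ hfz ?_
    rw [Complex.tan, h, div_zero]
  · exact fun h ↦ transcendental_sin hz hz0 (by simpa [csc] using h.inv)
  · exact fun h ↦ transcendental_cos hz hz0 (by simpa [sec] using h.inv)
  · have hc : Complex.cos z ≠ 0 := fun h ↦ hfz (by rw [Complex.cot, h, zero_div])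
    refine fun h ↦ transcendental_tan hz hz0 hc ?_
    simpa [Complex.cot, Complex.tan] using h.inv
  · exact transcendental_sinh hz hz0
  · exact transcendental_cosh hz hz0
  · refine transcendental_tanh hz hz0 fun h ↦ hfz ?_
    rw [Complex.tanh_eq_sinh_div_cosh, h, div_zero]
  · have hc : Complex.cosh z ≠ 0 := fun h ↦ hfz (by rw [coth, h, zero_div])
    refine fun h ↦ transcendental_tanh hz hz0 hc ?_
    simpa [coth, Complex.tanh_eq_sinh_div_cosh] using h.inv

theorem corollary4 (j : ℕ) (hj : 0 < j) (f : ℂ → ℂ) (hf : f ∈ ExpTrig.functions j)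
    (g : Polynomial ℚ) (a₁ : ℂ) (ha₁ : IsAlgebraic ℚ a₁) (k : ℕ) (hk : 0 < k)
    (α : ℂ) (hα : α ≠ 0)
    (hsol : (f α + a₁) ^ k = Polynomial.aeval α g)
    (hfα : f α ≠ 0) (hgα : Polynomial.aeval α g ≠ 0) :
    Transcendental ℚ α := by
  intro h
  refine ExpTrig.transcendental_apply hf h hα hfα ?_
  have hpow : IsAlgebraic ℚ ((f α + a₁) ^ k) := by
    rw [hsol, isAlgebraic_iff_isIntegral]
    exact Algebra.adjoin_le (S := integralClosure ℚ ℂ) (Set.singleton_subset_iff.mpr h.isIntegral)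
      (aeval_mem_adjoin_singleton ℚ α)
  simpa using (hpow.of_pow hk).sub ha₁
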